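/- Let $(\mathcal X,\rho)$ be a metric space with $\rho\le 1$, equipped with a $\sigma$-algebra for which $\rho:\mathcal X\times\mathcal X\to\mathbb R$ is measurable. For a probability distribution $P$ on $\mathcal X$ and a finite nonempty $T\subseteq\mathcal X$ let $R(P,T)=\mathbb E_{X\sim P}[\min_{t\in T}\rho(X,t)]$, and let $R(P,\mathrm{OPT})=\inf_{T}R(P,T)$ over all $T=\{t_1,\dots,t_k\}\subseteq\mathcal X$. For a finite sample $S$ (a sequence, repetitions allowed) let $R(S,T)$ be the risk of $T$ under the uniform distribution on $S$, and $R(S,\mathrm{OPT}_S)=\inf_T R(S,T)$ over all $T=\{t_1,\dots,t_k\}\subseteq\mathcal X$. A $\beta$-approximation offline $k$-median algorithm $\mathcal A$ maps every sample $S$ of at least $k$ points to $k$ centers taken from $S$ such that $R(S,\mathcal A(S))\le\beta\,R(S,\mathrm{OPT}_S)$; here $\beta\ge1$. For elements $x,y$ of a sample $S$ let $\hat B_S(x,y)$ be the fraction of the elements of $S\setminus\{x,y\}$ (counted with multiplicity) whose distance from $x$ is at most $\rho(x,y)$. For $q>0$ let $\mathrm{qball}_S(x,q)$ be the closed ball around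 $x$ of radius $\min\{\rho(x,y): y\in S,\ \hat B_S(x,y)\ge q\}$ (all of $\mathcal X$ if there is no such $y$). The algorithm SKM, run with $k,m\in\mathbb N$, $\delta\in(0,1)$ and $\mathcal A$ on a sequence $x_1,\dots,x_m$, does the following. It sets $q=43\ln(2m^2/\delta)/m$, $S_1=(x_1,\dots,x_{\lfloor m/2\rfloor})$, $\{c_1,\dots,c_k\}=\mathcal A(S_1)$ and $T_{\mathrm{out}}=\emptyset$. Then for $j=\lfloor m/2\rfloor+1,\dots,m$ in turn, it adds $x_j$ to $T_{\mathrm{out}}$ if for some $i$ both $x_j\in\mathrm{qball}_{S_1}(c_i,q)$ and $T_{\mathrm{out}}\cap\mathrm{qball}_{S_1}(c_i,q)=\emptyset$. It returns $T_{\mathrm{out}}$. **Theorem.** Let $k\ge1$, $m\ge\max(2k,24)$, $\delta\in(0,1)$, $\beta\ge1$, let $\mathcal A$ be a $\beta$-approximation offline $k$-median algorithm, let $P$ be any probability distribution on $\mathcal X$, and run SKM on an i.i.d. sample $(x_1,\dots,x_m)\sim P^m$. (1) For every $\gamma\in(0,\tfrac12)$, with probability at least $1-\delta$, $T_{\mathrm{out}}\neq\emptyset$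 and $$R(P,T_{\mathrm{out}})\le(2+2\gamma)\beta R(P,\mathrm{OPT})+\bigl((2+2\gamma)\beta+1\bigr)\sqrt{\frac{k\ln(m/2)+\ln(4/\delta)}{m}}+\frac1\gamma\cdot\frac{44k\ln(2m^2/\delta)}{m}.$$ (2) There is a universal constant $C>0$ (independent of $\mathcal X,P,k,m,\delta,\beta,\mathcal A$) such that, with probability at least $1-\delta$, $T_{\mathrm{out}}\neq\emptyset$ and $$R(P,T_{\mathrm{out}})\le2\beta R(P,\mathrm{OPT})+C\,\beta\sqrt{\frac{k\ln(m/\delta)}{m}}.$$ ("With probability at least $1-\delta$" means that the outer $P^m$-measure of the complementary event is at most $\delta$; no measurability of $\mathcal A$ is assumed.) -/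

import Mathlib

open MeasureTheory

namespace SKM

noncomputable section

/-- The `k`-median risk `R(P, T) = 𝔼[min_{t ∈ T} ρ(X, t)]`, `X ∼ P`, of a finite nonempty set `T` of
centers. (For `T = ∅` Mathlib's `Metric.infDist` is `0`, a value that is never relied upon: the
theorem asserts separately that the output is nonempty.) -/
def risk {X : Type*} [MetricSpace X] [MeasurableSpace X] (P : Measure X) (T : Set X) : ℝ :=
  ∫ x, Metric.infDist x T ∂P

/-- The risk `R(S, T)` of `T` on the uniform distribution over the finite sample `S`. A sample is a
finite sequence, so that repeated points count with multiplicity. -/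
def empRisk {X : Type*} [MetricSpace X] {n : ℕ} (S : Fin n → X) (T : Set X) : ℝ :=
  (∑ j, Metric.infDist (S j) T) / n

/-- The optimal risk `R(P, OPT)` over all `k`-clusterings `{t₁, …, tₖ} ⊆ X`. -/
def optRisk {X : Type*} [MetricSpace X] [MeasurableSpace X] (k : ℕ) (P : Measure X) : ℝ :=
  ⨅ T : Fin k → X, risk P (Set.range T)

/-- The optimal risk `R(S, OPT_S)` on the sample `S`, with centers from all of `X`. -/
def optEmpRisk {X : Type*} [MetricSpace X] (k : ℕ) {n : ℕ} (S : Fin n → X) : ℝ :=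
  ⨅ T : Fin k → X, empRisk S (Set.range T)

/-- An offline `k`-median algorithm: given a sample `S` of `n ≥ k` points it selects `k` elements
of `S` as centers, given by their positions in `S`. -/
abbrev OfflineAlgorithm (X : Type*) (k : ℕ) : Type _ :=
  ∀ n : ℕ, k ≤ n → (Fin n → X) → Fin k → Fin n

/-- `A` is a `β`-approximation algorithm: `R(S, A(S)) ≤ β · R(S, OPT_S)` for all inputs `S`. -/
def OfflineAlgorithm.IsApprox {X : Type*} [MetricSpace X] {k : ℕ} (A : OfflineAlgorithm X k)
    (β : ℝ) : Prop :=
  ∀ (n : ℕ) (hn : k ≤ n) (S : Fin n → X),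
    empRisk S (Set.range fun i => S (A n hn S i)) ≤ β * optEmpRisk k S

open Classical in
/-- `B̂_S(x, y)` for the sample elements `x = S a`, `y = S b`: the fraction of the elements of
`S \ {x, y}` that lie in `Ball(x, ρ(x, y))`. -/
def Bhat {X : Type*} [MetricSpace X] {n : ℕ} (S : Fin n → X) (a b : Fin n) : ℝ :=
  (((Finset.univ \ {a, b} : Finset (Fin n)).filter
      fun j => dist (S a) (S j) ≤ dist (S a) (S b)).card : ℝ) /
    ((Finset.univ \ {a, b} : Finset (Fin n)).card : ℝ)

/-- `y = S b` is a possible value of `qp_S(x, q)`, `x = S a`: a minimizer of `ρ(x, y)` among the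
`y ∈ S` with `B̂_S(x, y) ≥ q`. -/
def IsQp {X : Type*} [MetricSpace X] {n : ℕ} (S : Fin n → X) (a : Fin n) (q : ℝ) (b : Fin n) :
    Prop :=
  q ≤ Bhat S a b ∧ ∀ b', q ≤ Bhat S a b' → dist (S a) (S b) ≤ dist (S a) (S b')

/-- `qball_S(x, q) = Ball(x, ρ(x, qp_S(x, q)))` for `x = S a`. It does not depend on how ties are
broken in the choice of `qp`, see `qball_eq`. If there is no `y ∈ S` with `B̂_S(x, y) ≥ q`
(as happens for `q > 1`), it is the whole space. -/
def qball {X : Type*} [MetricSpace X] {n : ℕ} (S : Fin n → X) (a : Fin n) (q : ℝ) : Set X :=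
  {z | ∀ b, IsQp S a q b → dist (S a) z ≤ dist (S a) (S b)}

theorem qball_eq {X : Type*} [MetricSpace X] {n : ℕ} {S : Fin n → X} {a b : Fin n} {q : ℝ}
    (h : IsQp S a q b) : qball S a q = {z | dist (S a) z ≤ dist (S a) (S b)} := by
  ext z
  exact ⟨fun hz => hz b h, fun hz b' hb' => le_trans hz (h.2 b' hb'.1)⟩

open Classical in
/-- The selection phase: the points of the list are processed one by one, starting from the set of
centers `T`, and `x` is irrevocably selected when it arrives iff for some `i` it lies in `Q i` and
`Q i` contains no center selected so far. -/
def select {X : Type*} {k : ℕ} (Q : Fin k → Set X) (T : Set X) : List X → Set X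
  | [] => T
  | x :: l => select Q (if ∃ i, x ∈ Q i ∧ T ∩ Q i = ∅ then insert x T else T) l

/-- The value of `q` used by SKM. -/
def qval (m : ℕ) (δ : ℝ) : ℝ := 43 * Real.log (2 * (m : ℝ) ^ 2 / δ) / m

/-- The first phase sample `S₁ = (x₁, …, x_{⌊m/2⌋})`. -/
def firstHalf {X : Type*} {m : ℕ} (S : Fin m → X) : Fin (m / 2) → X :=
  fun i => S (Fin.castLE (Nat.div_le_self m 2) i)

/-- The second phase sample `S₂ = (x_{⌊m/2⌋+1}, …, x_m)`. -/
def secondHalf {X : Type*} {m : ℕ} (S : Fin m → X) : Fin (m - m / 2) → X :=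
  fun j => S ⟨m / 2 + j, by have := j.isLt; omega⟩

/-- The output `T_out` of SKM on the stream `S`, with parameters `k`, `m`, `δ` and the offline
algorithm `A`. -/
def Tout {X : Type*} [MetricSpace X] {k m : ℕ} (hkm : k ≤ m / 2) (δ : ℝ) (A : OfflineAlgorithm X k)
    (S : Fin m → X) : Set X :=
  select (fun i => qball (firstHalf S) (A (m / 2) hkm (firstHalf S) i) (qval m δ)) ∅
    (List.ofFn (secondHalf S))

end

end SKM

namespace SKM

open scoped ENNReal

/-! ### Products of independent factors and exponential moments. -/

section Probability

/-! Fix centers `c i` from the first half and let `r i` be the radius of the q-ball around `c i`.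
The open ball of radius `r i` holds few sample points, so any `t i` in the closed q-ball is nearly
as good a center as `c i`, up to a factor two: if the cluster of `c i` is large, most of its points
are at distance at least `r i` from `c i`, so moving the center by `r i` about doubles the cost; if
it is small, it costs little anyway (`sum_infDist_range_le`, `card_open_qball_le`).

Two probabilistic facts make this usable. First, each q-ball has large empirical mass, so the second
half hits it (`measure_large_ball_not_hit_le`). Then the selection picks, for each ball, its first
arrival (`select_eq`), and the output is a family of k points of the second half. Second, once the
second half is frozen, such a family is a fixed set of centers and the first half is a fresh sample,
so Hoeffding and a union bound over index families compare its empirical and true risks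
(`measure_exists_underestimated_le`). The approximation guarantee, and Hoeffding for near-optimal
centers, bring in the optimal risk.

Both union bounds run over all indices, whatever the offline algorithm chooses, so its measurability
plays no role. If the additive error in part (1) exceeds 1 the bound is trivial once the output is
nonempty. Part (2) takes γ equal to the square root in its error term, which balances the terms γ
and 1/γ. -/

theorem lintegral_pi_prod {ι X : Type*} [Fintype ι] [MeasurableSpace X] (P : Measure X)
    [IsProbabilityMeasure P] (g : ι → X → ℝ≥0∞) (hg : ∀ i, Measurable (g i)) :
    ∫⁻ x, ∏ i, g i (x i) ∂Measure.pi (fun _ : ι => P) = ∏ i, ∫⁻ z, g i z ∂P := by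
  have hind : ProbabilityTheory.iIndepFun (fun i (x : ι → X) => g i (x i))
      (Measure.pi fun _ : ι => P) := ProbabilityTheory.iIndepFun_pi fun i => (hg i).aemeasurable
  refine (ProbabilityTheory.lintegral_prod_eq_prod_lintegral_of_indepFun Finset.univ _ hind
    (fun i => (hg i).comp (measurable_pi_apply i))).trans ?_
  refine Finset.prod_congr rfl fun i _ => ?_
  exact (measurePreserving_eval (fun _ : ι => P) i).lintegral_comp (hg i)

/-- Conditionally on the coordinates outside `D`, the expectation of a product over `D` factors. -/
theorem lintegral_prod_le_of_condition {ι X : Type*} [Fintype ι] [DecidableEq ι]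
    [MeasurableSpace X] (P : Measure X) [IsProbabilityMeasure P] (D : Finset ι)
    (G : (ι → X) → ι → X → ℝ≥0∞) (c : ℝ≥0∞)
    (hmeas : Measurable fun x => ∏ j ∈ D, G x j (x j))
    (hG : ∀ x j, j ∈ D → Measurable (G x j))
    (hdep : ∀ x y : ι → X, (∀ i, i ∉ D → x i = y i) → ∀ j, j ∈ D → G x j = G y j)
    (hc : ∀ x, ∏ j ∈ D, ∫⁻ z, G x j z ∂P ≤ c) :
    ∫⁻ x, ∏ j ∈ D, G x j (x j) ∂Measure.pi (fun _ : ι => P) ≤ c := by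
  have := lintegral_le_of_lmarginal_le (μ := fun _ : ι => P) D hmeas
    (measurable_const (a := c)) ?_
  · simpa using this
  intro x
  have hconst : lmarginal (fun _ : ι => P) D (fun _ => c) x = c := by simp [lmarginal]
  rw [hconst]
  -- With the coordinates outside `D` frozen, the factors no longer depend on the variables being
  -- integrated, so the integral of the product splits.
  refine le_trans (le_of_eq ?_) (hc x)
  calc lmarginal (fun _ : ι => P) D (fun x => ∏ j ∈ D, G x j (x j)) x
      = ∫⁻ y : D → X, ∏ j : D, G x j (y j) ∂Measure.pi (fun _ : D => P) := by
        refine lintegral_congr fun y => ?_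
        beta_reduce
        rw [← Finset.prod_coe_sort D]
        refine Finset.prod_congr rfl fun j _ => ?_
        rw [hdep _ x (fun i hi => by simp [Function.updateFinset, hi]) j j.2]
        simp [Function.updateFinset]
    _ = ∏ j ∈ D, ∫⁻ z, G x j z ∂P := by
        rw [lintegral_pi_prod P (fun j : D => G x j) (fun j => hG x j j.2)]
        exact Finset.prod_coe_sort D fun j => ∫⁻ z, G x j z ∂P

theorem measure_le_lintegral_of_one_le {Ω : Type*} [MeasurableSpace Ω] (μ : Measure Ω)
    {F : Ω → ℝ≥0∞} (hF : Measurable F) {E : Set Ω} (hE : ∀ x ∈ E, 1 ≤ F x) :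
    μ E ≤ ∫⁻ x, F x ∂μ := by
  calc μ E ≤ μ {x | 1 ≤ F x} := measure_mono hE
    _ ≤ ∫⁻ x, F x ∂μ := by simpa using mul_meas_ge_le_lintegral hF 1

/-- Hoeffding's lemma for an interval of length 1, at parameter `-s`. -/
theorem lintegral_exp_le_of_mem_Icc {X : Type*} [MeasurableSpace X] (P : Measure X)
    [IsProbabilityMeasure P] {f : X → ℝ} (hf : Measurable f) (h01 : ∀ x, f x ∈ Set.Icc (0 : ℝ) 1)
    (s : ℝ) :
    ∫⁻ z, ENNReal.ofReal (Real.exp (s * ((∫ x, f x ∂P) - f z))) ∂P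
      ≤ ENNReal.ofReal (Real.exp (s ^ 2 / 8)) := by
  have h := ProbabilityTheory.hasSubgaussianMGF_of_mem_Icc (μ := P) hf.aemeasurable
    (Filter.Eventually.of_forall h01)
  have hi := h.integrable_exp_mul (-s)
  have hm := h.mgf_le (-s)
  have heq : ∀ z, s * ((∫ x, f x ∂P) - f z) = -s * (f z - ∫ x, f x ∂P) := fun z => by ring
  simp_rw [heq]
  rw [← ofReal_integral_eq_lintegral_ofReal hi
    (Filter.Eventually.of_forall fun _ => (Real.exp_pos _).le)]
  refine ENNReal.ofReal_le_ofReal (hm.trans (le_of_eq ?_))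
  congr 1
  norm_num
  ring

end Probability

/-! ### Measurability and range of the risk. -/

section Measurability

variable {X : Type*} [MetricSpace X]

theorem infDist_range_eq_iInf {k : ℕ} (x : X) (t : Fin k → X) :
    Metric.infDist x (Set.range t) = ⨅ i, dist x (t i) := by
  rw [Metric.infDist_eq_iInf]
  exact Function.Surjective.iInf_comp (g := fun y : Set.range t => dist x y)
    Set.rangeFactorization_surjective |>.symm

theorem infDist_range_le {k : ℕ} (x : X) (t : Fin k → X) (i : Fin k) :
    Metric.infDist x (Set.range t) ≤ dist x (t i) :=
  Metric.infDist_le_dist_of_mem ⟨i, rfl⟩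

theorem exists_infDist_range_eq {k : ℕ} (hk : 1 ≤ k) (x : X) (t : Fin k → X) :
    ∃ i, Metric.infDist x (Set.range t) = dist x (t i) := by
  have : Nonempty (Fin k) := ⟨⟨0, hk⟩⟩
  obtain ⟨_, ⟨i, rfl⟩, h⟩ :=
    (Set.finite_range t).isCompact.exists_infDist_eq_dist (Set.range_nonempty t) x
  exact ⟨i, h⟩

theorem infDist_range_mem_Icc (hdiam : ∀ x y : X, dist x y ≤ 1) {k : ℕ} (hk : 1 ≤ k) (x : X)
    (t : Fin k → X) : Metric.infDist x (Set.range t) ∈ Set.Icc (0 : ℝ) 1 :=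
  ⟨Metric.infDist_nonneg, (infDist_range_le x t ⟨0, hk⟩).trans (hdiam _ _)⟩

theorem optEmpRisk_le {k n : ℕ} (S : Fin n → X) (t : Fin k → X) :
    optEmpRisk k S ≤ empRisk S (Set.range t) :=
  ciInf_le ⟨0, by
    rintro _ ⟨t, rfl⟩
    exact div_nonneg (Finset.sum_nonneg fun _ _ => Metric.infDist_nonneg) n.cast_nonneg⟩ t

variable [MeasurableSpace X]

/-- The σ-algebra need not be Borel; only `hmeas` is available, so the distance to the centers is
handled as a finite infimum of measurable distances. -/
theorem measurable_infDist_range (hmeas : Measurable fun p : X × X => dist p.1 p.2)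
    {Ω : Type*} [MeasurableSpace Ω] {k : ℕ} {f : Ω → X} (hf : Measurable f)
    {t : Ω → Fin k → X} (ht : ∀ i, Measurable fun ω => t ω i) :
    Measurable fun ω => Metric.infDist (f ω) (Set.range (t ω)) := by
  simp_rw [infDist_range_eq_iInf]
  exact Measurable.iInf fun i => hmeas.comp (hf.prodMk (ht i))

theorem measurable_risk_range (hmeas : Measurable fun p : X × X => dist p.1 p.2)
    (P : Measure X) [IsProbabilityMeasure P]
    {Ω : Type*} [MeasurableSpace Ω] {k : ℕ}
    {t : Ω → Fin k → X} (ht : ∀ i, Measurable fun ω => t ω i) :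
    Measurable fun ω => risk P (Set.range (t ω)) := by
  have : Measurable fun p : Ω × X => Metric.infDist p.2 (Set.range (t p.1)) :=
    measurable_infDist_range hmeas measurable_snd fun i => (ht i).comp measurable_fst
  exact this.stronglyMeasurable.integral_prod_right.measurable

theorem risk_mem_Icc (hmeas : Measurable fun p : X × X => dist p.1 p.2)
    (hdiam : ∀ x y : X, dist x y ≤ 1) (P : Measure X) [IsProbabilityMeasure P] {k : ℕ}
    (hk : 1 ≤ k) (t : Fin k → X) : risk P (Set.range t) ∈ Set.Icc (0 : ℝ) 1 := by
  refine ⟨integral_nonneg fun x => Metric.infDist_nonneg, ?_⟩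
  have hm : Measurable fun x => Metric.infDist x (Set.range t) :=
    measurable_infDist_range hmeas measurable_id fun i => measurable_const
  have hi : Integrable (fun x => Metric.infDist x (Set.range t)) P :=
    Integrable.of_mem_Icc 0 1 hm.aemeasurable
      (Filter.Eventually.of_forall fun x => infDist_range_mem_Icc hdiam hk x t)
  calc risk P (Set.range t) ≤ ∫ _, (1 : ℝ) ∂P :=
        integral_mono hi (integrable_const _) fun x => (infDist_range_mem_Icc hdiam hk x t).2
    _ = 1 := by simp

theorem optRisk_mem_Icc (hmeas : Measurable fun p : X × X => dist p.1 p.2)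
    (hdiam : ∀ x y : X, dist x y ≤ 1) (P : Measure X) [IsProbabilityMeasure P] {k : ℕ}
    (hk : 1 ≤ k) : optRisk k P ∈ Set.Icc (0 : ℝ) 1 := by
  have : Nonempty X := nonempty_of_isProbabilityMeasure P
  have h0 : ∀ t : Fin k → X, 0 ≤ risk P (Set.range t) := fun t =>
    (risk_mem_Icc hmeas hdiam P hk t).1
  refine ⟨le_ciInf h0, ?_⟩
  exact (ciInf_le ⟨0, by rintro _ ⟨t, rfl⟩; exact h0 t⟩
    (fun _ => Classical.arbitrary X)).trans (risk_mem_Icc hmeas hdiam P hk _).2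

end Measurability

/-! ### Hoeffding bounds, with centers that may depend on the other coordinates. -/

section Hoeffding

variable {X : Type*} [MetricSpace X] [MeasurableSpace X]

/-- Chernoff's method, conditionally on the coordinates outside the sample `e`, which determine the
centers. The sign of `s` selects the tail. -/
theorem measure_sum_risk_sub_infDist_ge_le (hmeas : Measurable fun p : X × X => dist p.1 p.2)
    (hdiam : ∀ x y : X, dist x y ≤ 1) (P : Measure X) [IsProbabilityMeasure P]
    {ι : Type*} [Fintype ι] [DecidableEq ι] {n k : ℕ} (hk : 1 ≤ k) (e : Fin n ↪ ι)
    (T : (ι → X) → Fin k → X) (hT : ∀ i, Measurable fun S => T S i)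
    (hdep : ∀ S S' : ι → X, (∀ i, i ∉ Finset.univ.map e → S i = S' i) → T S = T S') (s : ℝ) :
    Measure.pi (fun _ : ι => P)
      {S | n * (s ^ 2 / 4) ≤
        s * ∑ j, (risk P (Set.range (T S)) - Metric.infDist (S (e j)) (Set.range (T S)))}
      ≤ ENNReal.ofReal (Real.exp (-(n * (s ^ 2 / 8)))) := by
  -- The threshold is spread evenly over the factors: each has mean at most exp(s²/8 - s²/4).
  set G : (ι → X) → ι → X → ℝ≥0∞ := fun S _ z => ENNReal.ofReal
    (Real.exp (s * (risk P (Set.range (T S)) - Metric.infDist z (Set.range (T S))))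
      * Real.exp (-(s ^ 2 / 4))) with hGdef
  have hFm : Measurable fun S : ι → X => ∏ j ∈ Finset.univ.map e, G S j (S j) := by
    refine Finset.measurable_prod _ fun j _ => ?_
    refine ENNReal.measurable_ofReal.comp (Measurable.mul_const (Real.measurable_exp.comp ?_) _)
    exact ((measurable_risk_range hmeas P hT).sub
      (measurable_infDist_range hmeas (measurable_pi_apply j) hT)).const_mul s
  refine (measure_le_lintegral_of_one_le _ hFm ?_).trans
    (lintegral_prod_le_of_condition P (Finset.univ.map e) G _ hFm ?_ ?_ ?_)
  · intro S hS
    simp only [hGdef, Finset.prod_map]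
    rw [← ENNReal.ofReal_prod_of_nonneg fun _ _ => by positivity, ENNReal.one_le_ofReal]
    simp_rw [← Real.exp_add]
    rw [← Real.exp_sum, Finset.sum_add_distrib, ← Finset.mul_sum]
    refine Real.one_le_exp ?_
    rw [Set.mem_ofPred_eq] at hS
    simp only [Finset.sum_const, Finset.card_univ, Fintype.card_fin, nsmul_eq_mul]
    linarith
  · intro S j _
    have h1 : Measurable fun z => Metric.infDist z (Set.range (T S)) :=
      measurable_infDist_range hmeas measurable_id fun i => measurable_const
    have h2 : Measurable fun z => s * (risk P (Set.range (T S)) - Metric.infDist z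
        (Set.range (T S))) := (h1.const_sub _).const_mul s
    exact ENNReal.measurable_ofReal.comp (h2.exp.mul_const _)
  · intro S S' h j _
    simp only [hGdef, hdep S S' h]
  · intro S
    rw [Finset.prod_map]
    have hfac : ∫⁻ z, ENNReal.ofReal
        (Real.exp (s * (risk P (Set.range (T S)) - Metric.infDist z (Set.range (T S))))
          * Real.exp (-(s ^ 2 / 4))) ∂P ≤ ENNReal.ofReal (Real.exp (-(s ^ 2 / 8))) := by
      simp_rw [ENNReal.ofReal_mul (Real.exp_pos _).le]
      rw [lintegral_mul_const' _ _ ENNReal.ofReal_ne_top]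
      have h1 := lintegral_exp_le_of_mem_Icc P
        (f := fun z => Metric.infDist z (Set.range (T S)))
        (measurable_infDist_range hmeas measurable_id fun i => measurable_const)
        (fun z => infDist_range_mem_Icc hdiam hk z (T S)) s
      calc _ ≤ ENNReal.ofReal (Real.exp (s ^ 2 / 8)) * ENNReal.ofReal (Real.exp (-(s ^ 2 / 4))) :=
            mul_le_mul_left h1 _
        _ = _ := by
            rw [← ENNReal.ofReal_mul (Real.exp_pos _).le, ← Real.exp_add]
            congr 2
            ring
    calc _ ≤ ∏ _j : Fin n, ENNReal.ofReal (Real.exp (-(s ^ 2 / 8))) :=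
          Finset.prod_le_prod' fun j _ => hfac
      _ = _ := by
          rw [Finset.prod_const, Finset.card_univ, Fintype.card_fin, ← ENNReal.ofReal_pow
            (Real.exp_pos _).le, ← Real.exp_nat_mul]
          congr 2
          ring

theorem measure_empRisk_add_le_risk_le (hmeas : Measurable fun p : X × X => dist p.1 p.2)
    (hdiam : ∀ x y : X, dist x y ≤ 1) (P : Measure X) [IsProbabilityMeasure P]
    {ι : Type*} [Fintype ι] [DecidableEq ι] {n k : ℕ} (hn : 1 ≤ n) (hk : 1 ≤ k) (e : Fin n ↪ ι)
    (T : (ι → X) → Fin k → X) (hT : ∀ i, Measurable fun S => T S i)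
    (hdep : ∀ S S' : ι → X, (∀ i, i ∉ Finset.univ.map e → S i = S' i) → T S = T S')
    {ε : ℝ} (hε : 0 ≤ ε) :
    Measure.pi (fun _ : ι => P)
      {S | empRisk (fun i => S (e i)) (Set.range (T S)) + ε ≤ risk P (Set.range (T S))}
      ≤ ENNReal.ofReal (Real.exp (-(2 * n * ε ^ 2))) := by
  -- The optimal parameter: the threshold n s²/4 becomes s · nε, and the exponent n s²/8 becomes
  -- 2nε².
  have h := measure_sum_risk_sub_infDist_ge_le hmeas hdiam P hk e T hT hdep (4 * ε)
  have hn' : (0 : ℝ) < n := by exact_mod_cast hn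
  refine (measure_mono fun S hS => ?_).trans (h.trans (le_of_eq ?_))
  · have hS' : (∑ j, Metric.infDist (S (e j)) (Set.range (T S))) / n + ε
        ≤ risk P (Set.range (T S)) := hS
    rw [← le_sub_iff_add_le, div_le_iff₀ hn'] at hS'
    simp only [Set.mem_ofPred_eq, Finset.sum_sub_distrib, Finset.sum_const, Finset.card_univ,
      Fintype.card_fin, nsmul_eq_mul]
    nlinarith
  · congr 2
    ring

theorem measure_risk_add_le_empRisk_le (hmeas : Measurable fun p : X × X => dist p.1 p.2)
    (hdiam : ∀ x y : X, dist x y ≤ 1) (P : Measure X) [IsProbabilityMeasure P]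
    {ι : Type*} [Fintype ι] [DecidableEq ι] {n k : ℕ} (hn : 1 ≤ n) (hk : 1 ≤ k) (e : Fin n ↪ ι)
    (t : Fin k → X) {ε : ℝ} (hε : 0 ≤ ε) :
    Measure.pi (fun _ : ι => P)
      {S | risk P (Set.range t) + ε ≤ empRisk (fun i => S (e i)) (Set.range t)}
      ≤ ENNReal.ofReal (Real.exp (-(2 * n * ε ^ 2))) := by
  have h := measure_sum_risk_sub_infDist_ge_le hmeas hdiam P hk e (fun _ => t)
    (fun _ => measurable_const) (fun _ _ _ => rfl) (-(4 * ε))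
  have hn' : (0 : ℝ) < n := by exact_mod_cast hn
  refine (measure_mono fun S hS => ?_).trans (h.trans (le_of_eq ?_))
  · have hS' : risk P (Set.range t) + ε ≤
      (∑ j, Metric.infDist (S (e j)) (Set.range t)) / n := hS
    rw [le_div_iff₀ hn'] at hS'
    simp only [Set.mem_ofPred_eq, Finset.sum_sub_distrib, Finset.sum_const, Finset.card_univ,
      Fintype.card_fin, nsmul_eq_mul]
    nlinarith
  · congr 2
    ring

/-- The optimal risk need not be attained, so Hoeffding is applied to η-optimal centers; letting η
tend to 0 costs nothing in the exponent. -/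
theorem measure_optRisk_add_lt_optEmpRisk_le
    (hmeas : Measurable fun p : X × X => dist p.1 p.2)
    (hdiam : ∀ x y : X, dist x y ≤ 1) (P : Measure X) [IsProbabilityMeasure P]
    {ι : Type*} [Fintype ι] [DecidableEq ι] {n k : ℕ} (hn : 1 ≤ n) (hk : 1 ≤ k) (e : Fin n ↪ ι)
    {ε : ℝ} (hε : 0 < ε) :
    Measure.pi (fun _ : ι => P)
      {S | optRisk k P + ε < optEmpRisk k (fun i => S (e i))}
      ≤ ENNReal.ofReal (Real.exp (-(2 * n * ε ^ 2))) := by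
  have : Nonempty X := nonempty_of_isProbabilityMeasure P
  have hη : ∀ η ∈ Set.Ioo 0 ε, Measure.pi (fun _ : ι => P)
      {S | optRisk k P + ε < optEmpRisk k (fun i => S (e i))}
      ≤ ENNReal.ofReal (Real.exp (-(2 * n * (ε - η) ^ 2))) := by
    intro η hη
    obtain ⟨t, ht⟩ := exists_lt_of_ciInf_lt
      (show (⨅ t : Fin k → X, risk P (Set.range t)) < optRisk k P + η from
        lt_add_of_pos_right _ hη.1)
    refine (measure_mono fun S hS => ?_).trans
      (measure_risk_add_le_empRisk_le hmeas hdiam P hn hk e t (sub_nonneg.2 hη.2.le))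
    have h1 : optRisk k P + ε < optEmpRisk k (fun i => S (e i)) := hS
    have h2 := optEmpRisk_le (fun i => S (e i)) t
    simp only [Set.mem_ofPred_eq]
    linarith
  have hcont : Continuous fun η : ℝ => ENNReal.ofReal (Real.exp (-(2 * n * (ε - η) ^ 2))) := by
    exact ENNReal.continuous_ofReal.comp (by fun_prop)
  have hlim := (hcont.tendsto 0).mono_left (nhdsWithin_le_nhds (s := Set.Ioi 0))
  simp only [sub_zero] at hlim
  exact ge_of_tendsto hlim (Filter.eventually_of_mem (Ioo_mem_nhdsGT hε) hη)

end Hoeffding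

/-! ### Balls of large empirical mass are hit by the second half. -/

section Hitting

variable {X : Type*}

theorem measurableSet_closedBall_of_measurable_dist [MetricSpace X] [MeasurableSpace X]
    (hmeas : Measurable fun p : X × X => dist p.1 p.2) (x : X) (r : ℝ) :
    MeasurableSet {z | dist x z ≤ r} :=
  measurableSet_le (hmeas.comp (measurable_const.prodMk measurable_id)) measurable_const

open Classical in
-- The integrals are 1 + p and 1 - p with p = P(B), and (1 + p)(1 - p) ≤ 1.
theorem one_add_pow_mul_pow_le_one [MeasurableSpace X] (P : Measure X) [IsProbabilityMeasure P] {B : Set X}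
    (hB : MeasurableSet B) {a b : ℕ} (hab : a ≤ b) :
    (∫⁻ z, (if z ∈ B then 2 else 1) ∂P) ^ a * (∫⁻ z, (if z ∈ B then 0 else 1) ∂P) ^ b ≤ 1 := by
  have h1 : ∫⁻ z, (if z ∈ B then 2 else 1) ∂P = 1 + P B := by
    have : ∀ z, (if z ∈ B then (2 : ℝ≥0∞) else 1) = 1 + B.indicator 1 z := by
      intro z
      by_cases h : z ∈ B <;> simp [h, one_add_one_eq_two]
    simp_rw [this]
    rw [lintegral_add_left measurable_const, lintegral_indicator_one hB]
    simp
  have h2 : ∫⁻ z, (if z ∈ B then 0 else 1) ∂P = P Bᶜ := by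
    rw [← lintegral_indicator_one hB.compl]
    refine lintegral_congr fun z => ?_
    by_cases h : z ∈ B <;> simp [h]
  rw [h1, h2]
  have h3 : (1 + P B) * P Bᶜ ≤ 1 := by
    calc (1 + P B) * P Bᶜ = P Bᶜ + P B * P Bᶜ := by ring
      _ ≤ P Bᶜ + P B * 1 := by gcongr; exact prob_le_one
      _ = 1 := by rw [mul_one, add_comm, prob_add_prob_compl hB]
  calc (1 + P B) ^ a * P Bᶜ ^ b ≤ (1 + P B) ^ b * P Bᶜ ^ b := by
        gcongr
        exact le_self_add
    _ = ((1 + P B) * P Bᶜ) ^ b := (mul_pow _ _ _).symm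
    _ ≤ 1 := pow_le_one₀ zero_le h3

open Classical in
theorem card_filter_ge_of_le_Bhat [MetricSpace X] {n : ℕ} (hn : 3 ≤ n) {S : Fin n → X} {a b : Fin n} {q : ℝ}
    (hq : 0 ≤ q) (h : q ≤ Bhat S a b) :
    q * (n - 2) ≤ (((Finset.univ \ {a, b} : Finset (Fin n)).filter
      fun j => dist (S a) (S j) ≤ dist (S a) (S b)).card : ℝ) := by
  have hcard : n - 2 ≤ (Finset.univ \ {a, b} : Finset (Fin n)).card := by
    have h1 := Finset.le_card_sdiff ({a, b} : Finset (Fin n)) Finset.univ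
    have h2 := Finset.card_le_two (a := a) (b := b)
    simp only [Finset.card_univ, Fintype.card_fin] at h1
    omega
  have hpos : (0 : ℝ) < (Finset.univ \ {a, b} : Finset (Fin n)).card := by
    exact_mod_cast (by omega : 0 < n - 2).trans_le hcard
  have hcard' : (n : ℝ) - 2 ≤ (Finset.univ \ {a, b} : Finset (Fin n)).card := by
    have : (((n - 2 : ℕ) : ℝ)) ≤ (Finset.univ \ {a, b} : Finset (Fin n)).card := by
      exact_mod_cast hcard
    rwa [Nat.cast_sub (by omega)] at this
  unfold Bhat at h
  rw [le_div_iff₀ (by convert hpos)] at h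
  refine (mul_le_mul_of_nonneg_left hcard' hq).trans ?_
  convert h

open Classical in
-- Weight each first-half point in the ball by 2 and each second-half point in it by 0. The product
-- has mean at most 1, but equals 2^N when the ball is missed and contains N weighted first-half
-- points; Markov's inequality concludes. No concentration of the empirical mass is needed.
theorem measure_large_ball_not_hit_le [MetricSpace X] [MeasurableSpace X]
    (hmeas : Measurable fun p : X × X => dist p.1 p.2)
    (P : Measure X) [IsProbabilityMeasure P] {ι : Type*} [Fintype ι] {n n' : ℕ}
    (hn : 3 ≤ n) (hnn' : n ≤ n') (e : Fin n ↪ ι) (e' : Fin n' ↪ ι)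
    (hee' : ∀ i j, e i ≠ e' j) {q : ℝ} (hq : 0 ≤ q) (a b : Fin n) :
    Measure.pi (fun _ : ι => P)
      {S | q ≤ Bhat (fun i => S (e i)) a b ∧
        ∀ j, dist (S (e a)) (S (e b)) < dist (S (e a)) (S (e' j))}
      ≤ ENNReal.ofReal (Real.exp (-(Real.log 2 * (q * (n - 2))))) := by
  set D₁ : Finset ι := (Finset.univ \ {a, b} : Finset (Fin n)).map e with hD₁
  set D₂ : Finset ι := Finset.univ.map e' with hD₂
  set B : (ι → X) → Set X := fun S => {z | dist (S (e a)) z ≤ dist (S (e a)) (S (e b))} with hB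
  set G : (ι → X) → ι → X → ℝ≥0∞ := fun S j z =>
    if j ∈ D₂ then (if z ∈ B S then 0 else 1) else (if z ∈ B S then 2 else 1) with hG
  set c : ℝ≥0∞ := ENNReal.ofReal (Real.exp (-(Real.log 2 * (q * (n - 2))))) with hc
  have hdisj : Disjoint D₁ D₂ := by
    rw [Finset.disjoint_left]
    intro x hx hx'
    simp only [hD₁, hD₂, Finset.mem_map] at hx hx'
    obtain ⟨i, -, rfl⟩ := hx
    obtain ⟨j, -, hj⟩ := hx'
    exact hee' i j hj.symm
  have hBm : ∀ S, MeasurableSet (B S) := fun S =>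
    measurableSet_closedBall_of_measurable_dist hmeas _ _
  have hdist : ∀ i j : ι, Measurable fun S : ι → X => dist (S i) (S j) := fun i j =>
    hmeas.comp (g := fun p : X × X => dist p.1 p.2) (f := fun S : ι → X => (S i, S j))
      ((measurable_pi_apply i).prodMk (measurable_pi_apply j))
  have hFm : Measurable fun S : ι → X => ∏ j ∈ D₁ ∪ D₂, G S j (S j) := by
    refine Finset.measurable_prod _ fun j _ => ?_
    have hset : MeasurableSet {S : ι → X | S j ∈ B S} :=
      measurableSet_le (hdist _ _) (hdist _ _)
    by_cases hj : j ∈ D₂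
    · simp only [hG, hj, if_true]
      exact Measurable.ite hset measurable_const measurable_const
    · simp only [hG, hj, if_false]
      exact Measurable.ite hset measurable_const measurable_const
  have hsplit₁ : ∀ S, ∀ j ∈ D₁, G S j = fun z => if z ∈ B S then 2 else 1 := by
    intro S j hj
    simp only [hG, Finset.disjoint_left.1 hdisj hj, if_false]
  have hsplit₂ : ∀ S, ∀ j ∈ D₂, G S j = fun z => if z ∈ B S then 0 else 1 := by
    intro S j hj
    simp only [hG, hj, if_true]
  have hint : ∫⁻ S, ∏ j ∈ D₁ ∪ D₂, G S j (S j) ∂Measure.pi (fun _ : ι => P) ≤ 1 := by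
    refine lintegral_prod_le_of_condition P (D₁ ∪ D₂) G 1 hFm ?_ ?_ ?_
    · intro S j _
      by_cases hj : j ∈ D₂
      · simp only [hG, hj, if_true]
        exact Measurable.ite (hBm S) measurable_const measurable_const
      · simp only [hG, hj, if_false]
        exact Measurable.ite (hBm S) measurable_const measurable_const
    · intro S S' h j _
      -- The ball is determined by the points at `a` and `b`, which is why `D₁` omits them.
      have hmem : ∀ i ∈ ({a, b} : Finset (Fin n)), e i ∉ D₁ ∪ D₂ := by
        intro i hi hiD
        simp only [hD₁, hD₂, Finset.mem_union, Finset.mem_map, Finset.mem_sdiff] at hiD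
        rcases hiD with ⟨x, ⟨-, hx⟩, hxi⟩ | ⟨x, -, hxi⟩
        · exact hx (e.injective hxi ▸ hi)
        · exact hee' i x hxi.symm
      simp only [hG, hB, h _ (hmem a (by simp)), h _ (hmem b (by simp))]
    · intro S
      rw [Finset.prod_union hdisj,
        Finset.prod_congr rfl fun j hj => by rw [hsplit₁ S j hj],
        Finset.prod_congr (s₁ := D₂) rfl fun j hj => by rw [hsplit₂ S j hj],
        Finset.prod_const, Finset.prod_const]
      refine one_add_pow_mul_pow_le_one P (hBm S) ?_
      simp only [hD₁, hD₂, Finset.card_map, Finset.card_univ, Fintype.card_fin]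
      exact (Finset.card_le_univ _).trans (by simpa using hnn')
  calc _ ≤ ∫⁻ S, c * ∏ j ∈ D₁ ∪ D₂, G S j (S j) ∂Measure.pi (fun _ : ι => P) := by
        refine measure_le_lintegral_of_one_le _ (hFm.const_mul c) fun S hS => ?_
        obtain ⟨hS₁, hS₂⟩ := hS
        have hcount := card_filter_ge_of_le_Bhat hn hq hS₁
        set N := ((Finset.univ \ {a, b} : Finset (Fin n)).filter
          fun j => dist (S (e a)) (S (e j)) ≤ dist (S (e a)) (S (e b))).card with hN
        have hp₂ : ∏ j ∈ D₂, G S j (S j) = 1 := by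
          refine Finset.prod_eq_one fun j hj => ?_
          rw [hsplit₂ S j hj]
          obtain ⟨i, -, rfl⟩ := Finset.mem_map.1 hj
          have : S (e' i) ∉ B S := fun hmem => (hS₂ i).not_ge hmem
          simp only [this, if_false]
        have hp₁ : ∏ j ∈ D₁, G S j (S j) = 2 ^ N := by
          rw [Finset.prod_congr rfl fun j hj => by rw [hsplit₁ S j hj], hD₁, Finset.prod_map,
            Finset.prod_ite]
          simp only [Finset.prod_const, one_pow, mul_one, hN]
          congr 2
        rw [Finset.prod_union hdisj, hp₁, hp₂, mul_one, hc,
          show (2 : ℝ≥0∞) ^ N = ENNReal.ofReal (Real.exp (Real.log 2 * N)) by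
            rw [mul_comm, Real.exp_nat_mul, Real.exp_log two_pos, ENNReal.ofReal_pow two_pos.le]
            simp,
          ← ENNReal.ofReal_mul (Real.exp_pos _).le, ← Real.exp_add, ENNReal.one_le_ofReal]
        refine Real.one_le_exp ?_
        have := mul_le_mul_of_nonneg_left hcount (Real.log_nonneg one_le_two)
        linarith
    _ = c * ∫⁻ S, ∏ j ∈ D₁ ∪ D₂, G S j (S j) ∂Measure.pi (fun _ : ι => P) :=
        lintegral_const_mul c hFm
    _ ≤ c * 1 := by gcongr
    _ = c := mul_one c

end Hitting

/-! ### The outcome of the selection phase. -/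

section Selection

open Classical in
/-- The selected points are the first arrivals in those sets that are not hit beforehand. -/
theorem select_eq {X : Type*} {k : ℕ} (Q : Fin k → Set X) (T : Set X) (l : List X) :
    select Q T l = T ∪ {x | ∃ i, T ∩ Q i = ∅ ∧ l.find? (fun y => y ∈ Q i) = some x} := by
  induction l generalizing T with
  | nil => simp [select]
  | cons y l ih =>
    rw [select, ih]
    ext z
    -- If `y` is selected, it is the first arrival in each unhit set containing it. Otherwise no
    -- unhit set contains `y`, and every relevant search skips it.
    by_cases hy : ∃ i, y ∈ Q i ∧ T ∩ Q i = ∅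
    · rw [if_pos (by convert hy)]
      have hins : ∀ i, insert y T ∩ Q i = ∅ ↔ T ∩ Q i = ∅ ∧ y ∉ Q i := by
        intro i
        simp only [Set.eq_empty_iff_forall_notMem, Set.mem_inter_iff, Set.mem_insert_iff]
        constructor
        · intro h
          exact ⟨fun x hx => h x ⟨Or.inr hx.1, hx.2⟩, fun hyi => h y ⟨Or.inl rfl, hyi⟩⟩
        · rintro ⟨h, hyi⟩ x ⟨rfl | hx, hxi⟩
          · exact hyi hxi
          · exact h x ⟨hx, hxi⟩
      simp only [Set.mem_union, Set.mem_insert_iff, Set.mem_ofPred_eq, hins]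
      constructor
      · rintro ((rfl | hz) | ⟨i, ⟨hi, hyi⟩, hf⟩)
        · obtain ⟨i, hyi, hi⟩ := hy
          exact Or.inr ⟨i, hi, by simp [hyi]⟩
        · exact Or.inl hz
        · exact Or.inr ⟨i, hi, by simpa [List.find?_cons, hyi] using hf⟩
      · rintro (hz | ⟨i, hi, hf⟩)
        · exact Or.inl (Or.inr hz)
        · by_cases hyi : y ∈ Q i
          · simp only [List.find?_cons, hyi, decide_true, Option.some.injEq] at hf
            exact Or.inl (Or.inl hf.symm)
          · exact Or.inr ⟨i, ⟨hi, hyi⟩, by simpa [List.find?_cons, hyi] using hf⟩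
    · rw [if_neg (by convert hy)]
      simp only [Set.mem_union, Set.mem_ofPred_eq]
      refine or_congr Iff.rfl (exists_congr fun i => and_congr_right fun hi => ?_)
      have hyi : y ∉ Q i := fun h => hy ⟨i, h, hi⟩
      simp [hyi]

theorem exists_select_eq_range {X : Type*} {k n : ℕ} (Q : Fin k → Set X) (s : Fin n → X)
    (h : ∀ i, ∃ j, s j ∈ Q i) :
    ∃ f : Fin k → Fin n, (∀ i, s (f i) ∈ Q i) ∧
      select Q ∅ (List.ofFn s) = Set.range fun i => s (f i) := by
  classical
  have hfind : ∀ i, ∃ j, (List.ofFn s).find? (fun y => y ∈ Q i) = some (s j) ∧ s j ∈ Q i := by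
    intro i
    obtain ⟨j, hj⟩ := h i
    have hsome : ((List.ofFn s).find? (fun y => y ∈ Q i)).isSome := by
      rw [List.find?_isSome]
      exact ⟨s j, by simp [List.mem_ofFn], by simpa using hj⟩
    obtain ⟨x, hx⟩ := Option.isSome_iff_exists.1 hsome
    obtain ⟨j', rfl⟩ := (List.mem_ofFn' ..).1 (List.mem_of_find?_eq_some hx)
    exact ⟨j', hx, by simpa using List.find?_some hx⟩
  choose f hf hfQ using hfind
  refine ⟨f, hfQ, ?_⟩
  rw [select_eq]
  ext z
  simp only [Set.empty_union, Set.empty_inter, true_and, Set.mem_ofPred_eq, Set.mem_range]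
  refine exists_congr fun i => ?_
  have := hf i
  constructor
  · intro hz
    have h2 : some (s (f i)) = some z := by rw [← this]; convert hz
    exact Option.some.inj h2
  · rintro rfl
    convert this

end Selection

/-! ### Cost of moving centers within their q-balls. -/

section Transfer

variable {X : Type*} [MetricSpace X]

open Classical in
/-- Replacing each center `c i` by a point `t i` at distance at most `r i`, where the open ball of
radius `r i` around `c i` contains few sample points, nearly at most doubles the total cost. -/
theorem sum_infDist_range_le (hdiam : ∀ x y : X, dist x y ≤ 1) {n k : ℕ} (hk : 1 ≤ k)
    (S : Fin n → X) (c t : Fin k → X) (r : Fin k → ℝ) (hr : ∀ i, dist (c i) (t i) ≤ r i)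
    {γ N : ℝ} (hγ : γ ∈ Set.Ioo (0 : ℝ) (1 / 2))
    (hN : ∀ i, ((Finset.univ.filter fun j => dist (c i) (S j) < r i).card : ℝ) ≤ N) :
    ∑ j, Metric.infDist (S j) (Set.range t) ≤
      (2 + 2 * γ) * ∑ j, Metric.infDist (S j) (Set.range c) + k * (N / γ) := by
  obtain ⟨hγ0, hγ2⟩ := hγ
  choose φ hφ using fun j => exists_infDist_range_eq hk (S j) c
  have hcl : ∀ i, ∑ j with φ j = i, Metric.infDist (S j) (Set.range t) ≤
      (2 + 2 * γ) * (∑ j with φ j = i, Metric.infDist (S j) (Set.range c)) + N / γ := by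
    intro i
    set C := Finset.univ.filter fun j => φ j = i with hC
    have hr0 : 0 ≤ r i := dist_nonneg.trans (hr i)
    have hN0 : 0 ≤ N := (Nat.cast_nonneg _).trans (hN i)
    have hD0 : 0 ≤ ∑ j ∈ C, Metric.infDist (S j) (Set.range c) :=
      Finset.sum_nonneg fun _ _ => Metric.infDist_nonneg
    -- A small cluster has at most `N / γ` points, each costing at most 1; in a large one at most a
    -- fraction γ of the points lies in the open ball.
    by_cases hcase : γ * C.card ≤ N
    · have h1 : ∑ j ∈ C, Metric.infDist (S j) (Set.range t) ≤ C.card := by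
        calc _ ≤ ∑ _j ∈ C, (1 : ℝ) :=
              Finset.sum_le_sum fun j _ => (infDist_range_mem_Icc hdiam hk _ _).2
          _ = C.card := by simp
      have h2 : (C.card : ℝ) ≤ N / γ := by
        rw [le_div_iff₀ hγ0]
        linarith
      nlinarith
    · push Not at hcase
      set O := C.filter fun j => dist (c i) (S j) < r i with hO
      have hOC : O ⊆ C := Finset.filter_subset _ _
      have hOcard : (O.card : ℝ) ≤ γ * C.card := by
        refine le_trans ?_ ((hN i).trans hcase.le)
        exact_mod_cast Finset.card_le_card
          (Finset.filter_subset_filter _ (Finset.subset_univ C))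
      have h1 : ∑ j ∈ C, Metric.infDist (S j) (Set.range t) ≤
          (∑ j ∈ C, Metric.infDist (S j) (Set.range c)) + r i * C.card := by
        calc _ ≤ ∑ j ∈ C, (Metric.infDist (S j) (Set.range c) + r i) := by
              refine Finset.sum_le_sum fun j hj => ?_
              have hji : φ j = i := (Finset.mem_filter.1 hj).2
              rw [hφ j, hji]
              calc _ ≤ dist (S j) (t i) := infDist_range_le _ _ _
                _ ≤ dist (S j) (c i) + dist (c i) (t i) := dist_triangle _ _ _
                _ ≤ _ := by linarith [hr i]
          _ = _ := by
              rw [Finset.sum_add_distrib, Finset.sum_const, nsmul_eq_mul, mul_comm]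
      have h2 : r i * (C.card - O.card) ≤ ∑ j ∈ C, Metric.infDist (S j) (Set.range c) := by
        calc r i * (C.card - O.card) = ∑ _j ∈ C \ O, r i := by
              rw [Finset.sum_const, nsmul_eq_mul, Finset.card_sdiff_of_subset hOC,
                Nat.cast_sub (Finset.card_le_card hOC), mul_comm]
          _ ≤ ∑ j ∈ C \ O, Metric.infDist (S j) (Set.range c) := by
              refine Finset.sum_le_sum fun j hj => ?_
              obtain ⟨hjC, hjO⟩ := Finset.mem_sdiff.1 hj
              have hji : φ j = i := (Finset.mem_filter.1 hjC).2
              rw [hφ j, hji, dist_comm]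
              by_contra hlt
              exact hjO (Finset.mem_filter.2 ⟨hjC, not_le.1 hlt⟩)
          _ ≤ _ := Finset.sum_le_sum_of_subset_of_nonneg Finset.sdiff_subset
              fun _ _ _ => Metric.infDist_nonneg
      set D := ∑ j ∈ C, Metric.infDist (S j) (Set.range c)
      have h3 : r i * C.card * (1 - γ) ≤ D := by
        have := mul_le_mul_of_nonneg_left hOcard hr0
        linarith
      -- Uses (1 + 2γ)(1 - γ) = 1 + γ(1 - 2γ) ≥ 1; this is where γ < 1/2 enters.
      have h4 : r i * C.card ≤ (1 + 2 * γ) * D := by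
        have h5 := mul_le_mul_of_nonneg_left h3 (by linarith : 0 ≤ 1 + 2 * γ)
        have h6 : 0 ≤ r i * C.card := by positivity
        have h7 : 0 ≤ r i * C.card * (γ * (1 - 2 * γ)) :=
          mul_nonneg h6 (mul_nonneg hγ0.le (by linarith))
        nlinarith
      have h8 : 0 ≤ N / γ := by positivity
      linarith
  have hfib : ∀ g : Fin n → ℝ, ∑ j, g j = ∑ i, ∑ j with φ j = i, g j := fun g =>
    (Finset.sum_fiberwise _ _ _).symm
  rw [hfib fun j => Metric.infDist (S j) (Set.range t),
    hfib fun j => Metric.infDist (S j) (Set.range c), Finset.mul_sum]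
  calc _ ≤ ∑ i, ((2 + 2 * γ) * (∑ j with φ j = i, Metric.infDist (S j) (Set.range c)) + N / γ) :=
        Finset.sum_le_sum fun i _ => hcl i
    _ = _ := by
        rw [Finset.sum_add_distrib]
        simp

open Classical in
-- The farthest sample point `b'` in the open ball is closer than `b`, so minimality gives it
-- empirical mass below `q`. Its closed ball contains every sample point of the open one; the 2
-- accounts for `a` and `b'`, which `Bhat` leaves out.
theorem card_open_qball_le {n : ℕ} {S : Fin n → X} {a b : Fin n} {q : ℝ} (hq : 0 ≤ q)
    (h : IsQp S a q b) :
    ((Finset.univ.filter fun j => dist (S a) (S j) < dist (S a) (S b)).card : ℝ) ≤ q * n + 2 := by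
  set O := Finset.univ.filter fun j => dist (S a) (S j) < dist (S a) (S b) with hO
  rcases O.eq_empty_or_nonempty with hemp | hne
  · rw [hemp]
    simp only [Finset.card_empty, Nat.cast_zero]
    positivity
  obtain ⟨b', hb', hmax⟩ := O.exists_max_image (fun j => dist (S a) (S j)) hne
  have hlt : Bhat S a b' < q := by
    by_contra hge
    exact (h.2 b' (not_lt.1 hge)).not_gt (Finset.mem_filter.1 hb').2
  set U : Finset (Fin n) := Finset.univ \ {a, b'} with hU
  set V := U.filter fun j => dist (S a) (S j) ≤ dist (S a) (S b') with hV
  have hUn : (U.card : ℝ) ≤ n := by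
    exact_mod_cast (Finset.card_le_univ U).trans_eq (Fintype.card_fin n)
  have hVcard : (V.card : ℝ) ≤ q * n := by
    have hB : Bhat S a b' = (V.card : ℝ) / U.card := by
      unfold Bhat
      congr!
    rw [hB] at hlt
    rcases (Nat.cast_nonneg (α := ℝ) U.card).eq_or_lt with h0 | hpos
    · have hV0 : V.card ≤ U.card := Finset.card_filter_le _ _
      have : (V.card : ℝ) ≤ 0 := by rw [h0]; exact_mod_cast hV0
      exact this.trans (by positivity)
    · rw [div_lt_iff₀ hpos] at hlt
      exact hlt.le.trans (mul_le_mul_of_nonneg_left hUn hq)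
  have hsub : O ⊆ V ∪ {a, b'} := by
    intro j hj
    by_cases hjab : j ∈ ({a, b'} : Finset (Fin n))
    · exact Finset.mem_union_right _ hjab
    · exact Finset.mem_union_left _ (Finset.mem_filter.2
        ⟨Finset.mem_sdiff.2 ⟨Finset.mem_univ _, hjab⟩, hmax j hj⟩)
  have hcard : O.card ≤ V.card + 2 :=
    (Finset.card_le_card hsub).trans ((Finset.card_union_le _ _).trans
      (Nat.add_le_add_left Finset.card_le_two _))
  calc (O.card : ℝ) ≤ V.card + 2 := by exact_mod_cast hcard
    _ ≤ _ := by linarith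

theorem exists_isQp_of_le_Bhat {n : ℕ} {S : Fin n → X} {a b : Fin n} {q : ℝ}
    (h : q ≤ Bhat S a b) : ∃ b', IsQp S a q b' := by
  classical
  obtain ⟨b', hb', hmin⟩ := (Finset.univ.filter fun b => q ≤ Bhat S a b).exists_min_image
    (fun b => dist (S a) (S b)) ⟨b, by simpa using h⟩
  exact ⟨b', (Finset.mem_filter.1 hb').2, fun b'' h'' => hmin b'' (by simpa using h'')⟩

/-- The ball reaching the farthest sample point has empirical mass 1; `3 ≤ n` keeps the denominator
nonzero. -/
theorem exists_isQp_of_le_one {n : ℕ} (hn : 3 ≤ n) (S : Fin n → X) (a : Fin n) {q : ℝ}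
    (hq : q ≤ 1) : ∃ b, IsQp S a q b := by
  classical
  obtain ⟨b, -, hmax⟩ := Finset.univ.exists_max_image (fun j => dist (S a) (S j))
    ⟨a, Finset.mem_univ a⟩
  refine exists_isQp_of_le_Bhat (b := b) (hq.trans (le_of_eq ?_))
  have hcard : 0 < (Finset.univ \ {a, b} : Finset (Fin n)).card := by
    have h1 := Finset.le_card_sdiff ({a, b} : Finset (Fin n)) Finset.univ
    have h2 := Finset.card_le_two (a := a) (b := b)
    simp only [Finset.card_univ, Fintype.card_fin] at h1
    omega
  unfold Bhat
  rw [Finset.filter_true_of_mem fun j _ => hmax j (Finset.mem_univ j)]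
  exact (div_self (by exact_mod_cast hcard.ne')).symm

theorem exists_mem_qball {n n' : ℕ} (hn' : 1 ≤ n') {S : Fin n → X} {s : Fin n' → X} {q : ℝ}
    (h : ∀ a b, q ≤ Bhat S a b → ∃ j, dist (S a) (s j) ≤ dist (S a) (S b)) (a : Fin n) :
    ∃ j, s j ∈ qball S a q := by
  by_cases hb : ∃ b, IsQp S a q b
  · obtain ⟨b, hb⟩ := hb
    obtain ⟨j, hj⟩ := h a b hb.1
    refine ⟨j, ?_⟩
    rw [qball_eq hb]
    exact hj
  · exact ⟨⟨0, hn'⟩, fun b hb' => (hb ⟨b, hb'⟩).elim⟩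

end Transfer

/-! ### Numerical estimates for the failure probabilities and error terms. -/

section Numerics

variable {m k : ℕ} {δ : ℝ}

theorem five_le_log (hm : 24 ≤ m) (hδ : δ ∈ Set.Ioo (0 : ℝ) 1) :
    5 ≤ Real.log (2 * (m : ℝ) ^ 2 / δ) := by
  have hm' : (24 : ℝ) ≤ m := by exact_mod_cast hm
  have h1 : (1152 : ℝ) ≤ 2 * (m : ℝ) ^ 2 / δ := by
    rw [le_div_iff₀ hδ.1]
    nlinarith [hδ.2]
  rw [Real.le_log_iff_exp_le (by linarith)]
  calc Real.exp 5 = Real.exp 1 ^ 5 := by rw [← Real.exp_nat_mul]; norm_num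
    _ ≤ 3 ^ 5 := by
        gcongr
        exact Real.exp_one_lt_three.le
    _ ≤ _ := by norm_num; linarith

theorem log_deviation_nonneg (hm : 24 ≤ m) (hδ : δ ∈ Set.Ioo (0 : ℝ) 1) (hk : 1 ≤ k) :
    0 < k * Real.log ((m : ℝ) / 2) + Real.log (4 / δ) := by
  have hm' : (24 : ℝ) ≤ m := by exact_mod_cast hm
  have hk' : (1 : ℝ) ≤ k := by exact_mod_cast hk
  have h1 : 0 < Real.log ((m : ℝ) / 2) := Real.log_pos (by linarith)
  have h2 : 0 < Real.log (4 / δ) := Real.log_pos (by rw [lt_div_iff₀ hδ.1]; linarith [hδ.2])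
  positivity

theorem log_deviation_le (hm : 24 ≤ m) (hδ : δ ∈ Set.Ioo (0 : ℝ) 1) (hk : 1 ≤ k) :
    k * Real.log ((m : ℝ) / 2) + Real.log (4 / δ) ≤ 2 * (k * Real.log (2 * (m : ℝ) ^ 2 / δ)) := by
  have hm' : (24 : ℝ) ≤ m := by exact_mod_cast hm
  have hk' : (1 : ℝ) ≤ k := by exact_mod_cast hk
  have hL := five_le_log hm hδ
  have h1 : Real.log ((m : ℝ) / 2) ≤ Real.log (2 * (m : ℝ) ^ 2 / δ) := by
    refine Real.log_le_log (by linarith) ?_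
    rw [le_div_iff₀ hδ.1]
    nlinarith [hδ.1, hδ.2]
  have h2 : Real.log (4 / δ) ≤ Real.log (2 * (m : ℝ) ^ 2 / δ) := by
    refine Real.log_le_log (div_pos four_pos hδ.1) ?_
    gcongr
    · exact hδ.1.le
    · nlinarith
  nlinarith

theorem half_sq_mul_exp_le (hm : 24 ≤ m) (hδ : δ ∈ Set.Ioo (0 : ℝ) 1) :
    ((m / 2 : ℕ) : ℝ) ^ 2 *
      Real.exp (-(Real.log 2 * (qval m δ * (((m / 2 : ℕ) : ℝ) - 2)))) ≤ δ / 8 := by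
  have hm' : (24 : ℝ) ≤ m := by exact_mod_cast hm
  have hL := five_le_log hm hδ
  have hn1 : (m : ℝ) ≤ 2 * ((m / 2 : ℕ) : ℝ) + 1 := by
    exact_mod_cast (by omega : m ≤ 2 * (m / 2) + 1)
  have hn2 : 2 * ((m / 2 : ℕ) : ℝ) ≤ m := by exact_mod_cast (by omega : 2 * (m / 2) ≤ m)
  have hn3 : (12 : ℝ) ≤ ((m / 2 : ℕ) : ℝ) := by exact_mod_cast (by omega : 12 ≤ m / 2)
  set n : ℝ := ((m / 2 : ℕ) : ℝ)
  set L := Real.log (2 * (m : ℝ) ^ 2 / δ) with hLdef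
  have hlog2 := Real.log_two_gt_d9
  have hexp : L ≤ Real.log 2 * (qval m δ * (n - 2)) := by
    have h1 : L * m ≤ Real.log 2 * (43 * L * (n - 2)) := by
      have h2 : (m : ℝ) ≤ 0.69 * (43 * (n - 2)) := by linarith
      have h3 : 0.69 * (43 * (n - 2)) ≤ Real.log 2 * (43 * (n - 2)) :=
        mul_le_mul_of_nonneg_right (by linarith) (by linarith)
      have := mul_le_mul_of_nonneg_left (h2.trans h3) (by linarith : (0 : ℝ) ≤ L)
      linarith
    have h4 : Real.log 2 * (qval m δ * (n - 2)) = Real.log 2 * (43 * L * (n - 2)) / m := by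
      unfold qval
      rw [← hLdef]
      ring
    rw [h4, le_div_iff₀ (by linarith)]
    exact h1
  have hexpL : Real.exp (-L) = δ / (2 * (m : ℝ) ^ 2) := by
    rw [Real.exp_neg, hLdef, Real.exp_log (div_pos (by positivity) hδ.1), inv_div]
  calc n ^ 2 * Real.exp (-(Real.log 2 * (qval m δ * (n - 2)))) ≤ (m / 2) ^ 2 * Real.exp (-L) := by
        gcongr
        linarith
    _ = δ / 8 := by
        rw [hexpL]
        have : (m : ℝ) ≠ 0 := by linarith
        field_simp
        ring

/-- Without rounding, the product would be exactly δ/4. Halving an odd `m` loses at most a factor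
exp((k + W)/m), which `hsmall` keeps below 2. -/
theorem pow_mul_exp_neg_le (hm : 24 ≤ m) (hδ : δ ∈ Set.Ioo (0 : ℝ) 1) (hk : 1 ≤ k)
    (hsmall : 88 * (k * Real.log (2 * (m : ℝ) ^ 2 / δ)) < m) :
    ((m - m / 2 : ℕ) : ℝ) ^ k * Real.exp (-(2 * ((m / 2 : ℕ) : ℝ) *
      ((k * Real.log ((m : ℝ) / 2) + Real.log (4 / δ)) / m))) ≤ δ / 2 := by
  have hm' : (24 : ℝ) ≤ m := by exact_mod_cast hm
  have hk' : (1 : ℝ) ≤ k := by exact_mod_cast hk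
  have hL := five_le_log hm hδ
  have hW := log_deviation_le hm hδ hk
  have hW0 := log_deviation_nonneg hm hδ hk
  set W := k * Real.log ((m : ℝ) / 2) + Real.log (4 / δ) with hWdef
  set L := Real.log (2 * (m : ℝ) ^ 2 / δ)
  have hn1 : (m : ℝ) - 1 ≤ 2 * ((m / 2 : ℕ) : ℝ) := by
    rw [sub_le_iff_le_add]
    exact_mod_cast (by omega : m ≤ 2 * (m / 2) + 1)
  have hn2 : ((m - m / 2 : ℕ) : ℝ) ≤ (m : ℝ) / 2 * (1 + 1 / m) := by
    have : 2 * ((m - m / 2 : ℕ) : ℝ) ≤ m + 1 := by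
      exact_mod_cast (by omega : 2 * (m - m / 2) ≤ m + 1)
    have h2 : (m : ℝ) / 2 * (1 + 1 / m) = (m + 1) / 2 := by field_simp
    linarith
  have hbase : ((m - m / 2 : ℕ) : ℝ) ≤ Real.exp (Real.log ((m : ℝ) / 2) + 1 / m) := by
    rw [Real.exp_add, Real.exp_log (by linarith)]
    refine hn2.trans (mul_le_mul_of_nonneg_left ?_ (by linarith))
    linarith [Real.add_one_le_exp (1 / (m : ℝ))]
  have hdiv : (m - 1) * (W / m) ≤ 2 * ((m / 2 : ℕ) : ℝ) * (W / m) :=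
    mul_le_mul_of_nonneg_right hn1 (by positivity)
  have hkm : (k + W) / m ≤ 1 / 2 := by
    rw [div_le_iff₀ (by linarith)]
    nlinarith
  have hδexp : δ / 2 = Real.exp (Real.log 2 - Real.log (4 / δ)) := by
    rw [Real.exp_sub, Real.exp_log two_pos, Real.exp_log (div_pos four_pos hδ.1)]
    field_simp
    norm_num
  calc _ ≤ Real.exp (Real.log ((m : ℝ) / 2) + 1 / m) ^ k * Real.exp (-((m - 1) * (W / m))) := by
        gcongr
    _ = Real.exp (k * (Real.log ((m : ℝ) / 2) + 1 / m) - (m - 1) * (W / m)) := by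
        rw [← Real.exp_nat_mul, ← Real.exp_add, ← sub_eq_add_neg]
    _ ≤ δ / 2 := by
        rw [hδexp, Real.exp_le_exp]
        have h1 : k * (Real.log ((m : ℝ) / 2) + 1 / m) - (m - 1) * (W / m)
            = (k + W) / m - Real.log (4 / δ) := by
          have h2 : (k : ℝ) * Real.log ((m : ℝ) / 2) = W - Real.log (4 / δ) := by
            rw [hWdef]; ring
          rw [mul_add, h2]
          have : (m : ℝ) ≠ 0 := by linarith
          field_simp
          ring
        rw [h1]
        linarith [Real.log_two_gt_d9]

theorem exp_neg_le_quarter (hm : 24 ≤ m) (hδ : δ ∈ Set.Ioo (0 : ℝ) 1) (hk : 1 ≤ k)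
    (hsmall : 88 * (k * Real.log (2 * (m : ℝ) ^ 2 / δ)) < m) :
    Real.exp (-(2 * ((m / 2 : ℕ) : ℝ) *
      ((k * Real.log ((m : ℝ) / 2) + Real.log (4 / δ)) / m))) ≤ δ / 4 := by
  have h := pow_mul_exp_neg_le hm hδ hk hsmall
  have h2 : (2 : ℝ) ≤ ((m - m / 2 : ℕ) : ℝ) ^ k := by
    have h3 : (2 : ℝ) ≤ ((m - m / 2 : ℕ) : ℝ) := by exact_mod_cast (by omega : 2 ≤ m - m / 2)
    exact h3.trans (le_self_pow₀ (by linarith) (by omega))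
  nlinarith [Real.exp_pos (-(2 * ((m / 2 : ℕ) : ℝ) *
      ((k * Real.log ((m : ℝ) / 2) + Real.log (4 / δ)) / m)))]

theorem excess_le (hm : 24 ≤ m) (hδ : δ ∈ Set.Ioo (0 : ℝ) 1) {γ : ℝ} (hγ : 0 < γ) :
    k * ((qval m δ * ((m / 2 : ℕ) : ℝ) + 2) / γ) / ((m / 2 : ℕ) : ℝ) ≤
      (1 / γ) * (44 * k * Real.log (2 * (m : ℝ) ^ 2 / δ)) / m := by
  have hm' : (24 : ℝ) ≤ m := by exact_mod_cast hm
  have hL := five_le_log hm hδ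
  have hn1 : (m : ℝ) ≤ 2 * ((m / 2 : ℕ) : ℝ) + 1 := by
    exact_mod_cast (by omega : m ≤ 2 * (m / 2) + 1)
  have hn3 : (12 : ℝ) ≤ ((m / 2 : ℕ) : ℝ) := by exact_mod_cast (by omega : 12 ≤ m / 2)
  set n : ℝ := ((m / 2 : ℕ) : ℝ)
  unfold qval
  set L := Real.log (2 * (m : ℝ) ^ 2 / δ)
  have hn0 : n ≠ 0 := by linarith
  have hm0 : (m : ℝ) ≠ 0 := by linarith
  -- The two excluded points raise the constant from 43 to 44.
  have h1 : 2 / n ≤ L / m := by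
    rw [div_le_div_iff₀ (by linarith) (by linarith)]
    nlinarith
  have h2 : k * ((43 * L / m * n + 2) / γ) / n = k / γ * (43 * (L / m) + 2 / n) := by
    field_simp
  have h3 : (1 / γ) * (44 * k * L) / m = k / γ * (44 * (L / m)) := by
    field_simp
  rw [h2, h3]
  refine mul_le_mul_of_nonneg_left ?_ (by positivity)
  linarith

end Numerics

/-! ### Analysis of SKM and its risk bounds. -/

section Algorithm

variable {X : Type*} [MetricSpace X]

/-- Some ball around a point of the first half, of empirical mass at least `q`, contains no point
of the second half. -/
def MissesLargeBall {m : ℕ} (q : ℝ) (S : Fin m → X) : Prop :=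
  ∃ a b, q ≤ Bhat (firstHalf S) a b ∧ ∀ j,
    dist (firstHalf S a) (firstHalf S b) < dist (firstHalf S a) (secondHalf S j)

theorem exists_Tout_eq_range {k m : ℕ} (hm : 24 ≤ m) (hkm : k ≤ m / 2) (δ : ℝ)
    (A : OfflineAlgorithm X k) {S : Fin m → X} (h : ¬ MissesLargeBall (qval m δ) S) :
    ∃ f : Fin k → Fin (m - m / 2),
      (∀ i, secondHalf S (f i) ∈
        qball (firstHalf S) (A (m / 2) hkm (firstHalf S) i) (qval m δ)) ∧
      Tout hkm δ A S = Set.range fun i => secondHalf S (f i) := by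
  refine exists_select_eq_range _ _ fun i => exists_mem_qball (by omega) (fun a b hab => ?_) _
  by_contra! hlt
  exact h ⟨a, b, hab, hlt⟩

theorem empRisk_select_le (hdiam : ∀ x y : X, dist x y ≤ 1) {n k : ℕ} (hn : 3 ≤ n) (hk : 1 ≤ k)
    (S : Fin n → X) (a : Fin k → Fin n) (t : Fin k → X) {q γ : ℝ} (hq : q ∈ Set.Icc (0 : ℝ) 1)
    (hγ : γ ∈ Set.Ioo (0 : ℝ) (1 / 2)) (ht : ∀ i, t i ∈ qball S (a i) q) :
    empRisk S (Set.range t) ≤ (2 + 2 * γ) * empRisk S (Set.range fun i => S (a i)) +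
      k * ((q * n + 2) / γ) / n := by
  choose b hb using fun i => exists_isQp_of_le_one hn S (a i) hq.2
  have h := sum_infDist_range_le hdiam hk S (fun i => S (a i)) t
    (fun i => dist (S (a i)) (S (b i))) (fun i => ht i _ (hb i)) hγ
    (fun i => card_open_qball_le hq.1 (hb i))
  have hn' : (0 : ℝ) < n := by exact_mod_cast (by omega : 0 < n)
  unfold empRisk
  rw [← mul_div_assoc, ← add_div]
  exact div_le_div_of_nonneg_right h hn'.le

variable [MeasurableSpace X]

theorem measure_missesLargeBall_le (hmeas : Measurable fun p : X × X => dist p.1 p.2)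
    (P : Measure X) [IsProbabilityMeasure P] {m : ℕ} (hm : 24 ≤ m) {δ : ℝ}
    (hδ : δ ∈ Set.Ioo (0 : ℝ) 1) :
    Measure.pi (fun _ : Fin m => P) {S | MissesLargeBall (qval m δ) S}
      ≤ ENNReal.ofReal (δ / 8) := by
  set e : Fin (m / 2) ↪ Fin m := Fin.castLEEmb (Nat.div_le_self m 2)
  set e' : Fin (m - m / 2) ↪ Fin m :=
    ⟨fun j => ⟨m / 2 + j, by have := j.isLt; omega⟩, fun i j h => by
      have := congrArg Fin.val h
      ext
      simpa using this⟩
  have hq : 0 ≤ qval m δ := by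
    have := five_le_log hm hδ
    unfold qval
    positivity
  have hab := measure_large_ball_not_hit_le hmeas P (by omega : 3 ≤ m / 2)
    (by omega : m / 2 ≤ m - m / 2) e e' (fun i j h => by
      have := congrArg Fin.val h
      have h1 : (i : ℕ) = m / 2 + j := this
      have := i.isLt
      omega) hq
  have hset : {S : Fin m → X | MissesLargeBall (qval m δ) S} = ⋃ p : Fin (m / 2) × Fin (m / 2),
      {S | qval m δ ≤ Bhat (fun i => S (e i)) p.1 p.2 ∧
        ∀ j, dist (S (e p.1)) (S (e p.2)) < dist (S (e p.1)) (S (e' j))} := by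
    ext S
    simp only [Set.mem_ofPred_eq, Set.mem_iUnion, Prod.exists]
    rfl
  rw [hset]
  calc _ ≤ ∑ _p : Fin (m / 2) × Fin (m / 2), ENNReal.ofReal
          (Real.exp (-(Real.log 2 * (qval m δ * (((m / 2 : ℕ) : ℝ) - 2))))) :=
        (measure_iUnion_fintype_le _ _).trans (Finset.sum_le_sum fun p _ => hab p.1 p.2)
    _ = ENNReal.ofReal (((m / 2 : ℕ) : ℝ) ^ 2 *
          Real.exp (-(Real.log 2 * (qval m δ * (((m / 2 : ℕ) : ℝ) - 2))))) := by
        rw [ENNReal.ofReal_mul (by positivity), Finset.sum_const, nsmul_eq_mul,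
          ENNReal.ofReal_pow (by positivity), ENNReal.ofReal_natCast]
        simp [sq]
    _ ≤ _ := ENNReal.ofReal_le_ofReal (half_sq_mul_exp_le hm hδ)

/-- For each fixed `f` the centers depend only on the second half, so Hoeffding applies on the
first. The union over `f` covers every possible output, however the output depends on both halves.
-/
theorem measure_exists_underestimated_le (hmeas : Measurable fun p : X × X => dist p.1 p.2)
    (hdiam : ∀ x y : X, dist x y ≤ 1) (P : Measure X) [IsProbabilityMeasure P] {k m : ℕ}
    (hm : 24 ≤ m) (hk : 1 ≤ k) {δ : ℝ} (hδ : δ ∈ Set.Ioo (0 : ℝ) 1)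
    (hsmall : 88 * (k * Real.log (2 * (m : ℝ) ^ 2 / δ)) < m) :
    Measure.pi (fun _ : Fin m => P) {S | ∃ f : Fin k → Fin (m - m / 2),
        empRisk (firstHalf S) (Set.range fun i => secondHalf S (f i)) +
          Real.sqrt ((k * Real.log ((m : ℝ) / 2) + Real.log (4 / δ)) / m) ≤
        risk P (Set.range fun i => secondHalf S (f i))} ≤ ENNReal.ofReal (δ / 2) := by
  have hW0 := log_deviation_nonneg hm hδ hk
  set W := k * Real.log ((m : ℝ) / 2) + Real.log (4 / δ) with hW
  have hf := fun f : Fin k → Fin (m - m / 2) => measure_empRisk_add_le_risk_le hmeas hdiam P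
    (by omega : 1 ≤ m / 2) hk (Fin.castLEEmb (Nat.div_le_self m 2))
    (fun (S : Fin m → X) i => secondHalf S (f i)) (fun i => measurable_pi_apply _)
    (fun S S' h => by
      funext i
      refine h _ ?_
      simp only [Finset.mem_map, not_exists, not_and]
      intro j _ hj
      have h1 : (j : ℕ) = m / 2 + f i := congrArg Fin.val hj
      have := j.isLt
      omega) (Real.sqrt_nonneg (W / m))
  rw [Real.sq_sqrt (by positivity)] at hf
  have hset : {S : Fin m → X | ∃ f : Fin k → Fin (m - m / 2),
        empRisk (firstHalf S) (Set.range fun i => secondHalf S (f i)) + Real.sqrt (W / m) ≤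
        risk P (Set.range fun i => secondHalf S (f i))} = ⋃ f : Fin k → Fin (m - m / 2),
      {S | empRisk (firstHalf S) (Set.range fun i => secondHalf S (f i)) + Real.sqrt (W / m) ≤
        risk P (Set.range fun i => secondHalf S (f i))} := by
    ext S
    simp only [Set.mem_ofPred_eq, Set.mem_iUnion]
  rw [hset]
  calc _ ≤ ∑ _f : Fin k → Fin (m - m / 2), ENNReal.ofReal
          (Real.exp (-(2 * ((m / 2 : ℕ) : ℝ) * (W / m)))) :=
        (measure_iUnion_fintype_le _ _).trans (Finset.sum_le_sum fun f _ => hf f)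
    _ = ENNReal.ofReal (((m - m / 2 : ℕ) : ℝ) ^ k *
          Real.exp (-(2 * ((m / 2 : ℕ) : ℝ) * (W / m)))) := by
        rw [ENNReal.ofReal_mul (by positivity), Finset.sum_const, nsmul_eq_mul,
          ENNReal.ofReal_pow (by positivity), ENNReal.ofReal_natCast]
        simp
    _ ≤ _ := ENNReal.ofReal_le_ofReal (pow_mul_exp_neg_le hm hδ hk hsmall)

theorem measure_optRisk_underestimates_le (hmeas : Measurable fun p : X × X => dist p.1 p.2)
    (hdiam : ∀ x y : X, dist x y ≤ 1) (P : Measure X) [IsProbabilityMeasure P] {k m : ℕ}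
    (hm : 24 ≤ m) (hk : 1 ≤ k) {δ : ℝ} (hδ : δ ∈ Set.Ioo (0 : ℝ) 1)
    (hsmall : 88 * (k * Real.log (2 * (m : ℝ) ^ 2 / δ)) < m) :
    Measure.pi (fun _ : Fin m => P) {S | optRisk k P +
        Real.sqrt ((k * Real.log ((m : ℝ) / 2) + Real.log (4 / δ)) / m) <
        optEmpRisk k (firstHalf S)} ≤ ENNReal.ofReal (δ / 4) := by
  have hW0 := log_deviation_nonneg hm hδ hk
  have hm0 : (0 : ℝ) < m := by exact_mod_cast (by omega : 0 < m)
  have h := measure_optRisk_add_lt_optEmpRisk_le hmeas hdiam P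
    (by omega : 1 ≤ m / 2) hk (Fin.castLEEmb (Nat.div_le_self m 2))
    (Real.sqrt_pos.2 (div_pos hW0 hm0))
  rw [Real.sq_sqrt (by positivity)] at h
  exact h.trans (ENNReal.ofReal_le_ofReal (exp_neg_le_quarter hm hδ hk hsmall))

theorem measure_risk_Tout_gt_le (hmeas : Measurable fun p : X × X => dist p.1 p.2)
    (hdiam : ∀ x y : X, dist x y ≤ 1) (P : Measure X) [IsProbabilityMeasure P] {k m : ℕ}
    (hm : 24 ≤ m) (hk : 1 ≤ k) (hkm : k ≤ m / 2) {δ : ℝ} (hδ : δ ∈ Set.Ioo (0 : ℝ) 1)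
    {β : ℝ} (hβ : 1 ≤ β) (A : OfflineAlgorithm X k) (hA : A.IsApprox β)
    {γ : ℝ} (hγ : γ ∈ Set.Ioo (0 : ℝ) (1 / 2)) :
    Measure.pi (fun _ : Fin m => P)
      {S | ¬ ((Tout hkm δ A S).Nonempty ∧
        risk P (Tout hkm δ A S) ≤
          (2 + 2 * γ) * β * optRisk k P
          + ((2 + 2 * γ) * β + 1) *
              Real.sqrt ((k * Real.log ((m : ℝ) / 2) + Real.log (4 / δ)) / m)
          + (1 / γ) * (44 * k * Real.log (2 * (m : ℝ) ^ 2 / δ)) / m)}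
      ≤ ENNReal.ofReal δ := by
  have hm0 : (0 : ℝ) < m := by exact_mod_cast (by omega : 0 < m)
  have hk0 : (1 : ℝ) ≤ k := by exact_mod_cast hk
  have hL := five_le_log hm hδ
  have hopt := optRisk_mem_Icc hmeas hdiam P hk
  have hmiss := measure_missesLargeBall_le hmeas P hm hδ
  have hexc := excess_le (k := k) hm hδ hγ.1
  have : Nonempty (Fin k) := ⟨⟨0, hk⟩⟩
  set ε := Real.sqrt ((k * Real.log ((m : ℝ) / 2) + Real.log (4 / δ)) / m)
  have hε : 0 ≤ ε := Real.sqrt_nonneg _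
  have hcoef : 0 ≤ (2 + 2 * γ) * β := mul_nonneg (by linarith [hγ.1]) (by linarith)
  by_cases hsmall : 88 * (k * Real.log (2 * (m : ℝ) ^ 2 / δ)) < m
  · have hunder := measure_exists_underestimated_le hmeas hdiam P hm hk hδ hsmall
    have hoptm := measure_optRisk_underestimates_le hmeas hdiam P hm hk hδ hsmall
    refine (measure_mono fun S hS => ?_).trans ((measure_union_le _ _).trans
      ((add_le_add ((measure_union_le _ _).trans (add_le_add hmiss hunder)) hoptm).trans ?_))
    · by_contra hgood
      simp only [Set.mem_union, Set.mem_ofPred_eq, not_or, not_exists, not_le, not_lt] at hgood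
      obtain ⟨⟨hS₁, hS₂⟩, hS₃⟩ := hgood
      obtain ⟨f, hfQ, hT⟩ := exists_Tout_eq_range hm hkm δ A hS₁
      refine hS ⟨hT ▸ Set.range_nonempty _, ?_⟩
      rw [hT]
      -- Here `q ≤ 1` ensures that every q-ball is a genuine ball, not the whole space by default.
      have hq : qval m δ ∈ Set.Icc (0 : ℝ) 1 := by
        unfold qval
        refine ⟨by positivity, ?_⟩
        rw [div_le_one hm0]
        nlinarith
      have h1 := empRisk_select_le hdiam (by omega : 3 ≤ m / 2) hk (firstHalf S)
        (A (m / 2) hkm (firstHalf S)) (fun i => secondHalf S (f i)) hq hγ hfQ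
      have h2 := hA (m / 2) hkm (firstHalf S)
      have h3 := (hS₂ f).le
      have h4 := mul_le_mul_of_nonneg_left
        (h2.trans (mul_le_mul_of_nonneg_left hS₃ (by linarith : 0 ≤ β)))
        (by linarith [hγ.1] : 0 ≤ 2 + 2 * γ)
      linarith
    -- The failure probabilities are δ/8, δ/2 and δ/4.
    · rw [← ENNReal.ofReal_add (by linarith [hδ.1]) (by linarith [hδ.1]),
        ← ENNReal.ofReal_add (by linarith [hδ.1]) (by linarith [hδ.1])]
      exact ENNReal.ofReal_le_ofReal (by linarith [hδ.1])
  -- Now the last error term is at least 1/(2γ) ≥ 1, while the risk is at most 1; only nonemptiness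
  -- needs the hitting event.
  · refine (measure_mono fun S hS => ?_).trans
      (hmiss.trans (ENNReal.ofReal_le_ofReal (by linarith [hδ.1])))
    by_contra hgood
    obtain ⟨f, -, hT⟩ := exists_Tout_eq_range hm hkm δ A hgood
    refine hS ⟨hT ▸ Set.range_nonempty _, ?_⟩
    rw [hT]
    refine (risk_mem_Icc hmeas hdiam P hk _).2.trans ?_
    have h1 : 1 ≤ (1 / γ) * (44 * k * Real.log (2 * (m : ℝ) ^ 2 / δ)) / m := by
      rw [le_div_iff₀ hm0, div_mul_eq_mul_div, le_div_iff₀ hγ.1]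
      nlinarith [hγ.2]
    have h2 := mul_nonneg hcoef hopt.1
    have h3 := mul_nonneg hcoef hε
    linarith

theorem two_mul_optRisk_bound {k m : ℕ} (hm : 24 ≤ m) (hk : 1 ≤ k) {δ : ℝ}
    (hδ : δ ∈ Set.Ioo (0 : ℝ) 1) {β r : ℝ} (hβ : 1 ≤ β) (hr : r ∈ Set.Icc (0 : ℝ) 1) {γ : ℝ}
    (hγ : γ ∈ Set.Ioo (0 : ℝ) (1 / 2))
    (hγeq : γ = Real.sqrt (k * Real.log ((m : ℝ) / δ) / m)) :
    (2 + 2 * γ) * β * r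
      + ((2 + 2 * γ) * β + 1) *
          Real.sqrt ((k * Real.log ((m : ℝ) / 2) + Real.log (4 / δ)) / m)
      + (1 / γ) * (44 * k * Real.log (2 * (m : ℝ) ^ 2 / δ)) / m ≤
    2 * β * r + 142 * β * γ := by
  have hm' : (24 : ℝ) ≤ m := by exact_mod_cast hm
  have hk' : (1 : ℝ) ≤ k := by exact_mod_cast hk
  have hδ0 := hδ.1
  have hmδ : (m : ℝ) ≤ m / δ := by
    rw [le_div_iff₀ hδ0]
    nlinarith [hδ.2]
  have hl0 : 0 < Real.log ((m : ℝ) / δ) := Real.log_pos (by linarith)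
  have hl1 : Real.log ((m : ℝ) / 2) ≤ Real.log ((m : ℝ) / δ) :=
    Real.log_le_log (by linarith) (by linarith)
  have hl2 : Real.log (4 / δ) ≤ Real.log ((m : ℝ) / δ) := by
    refine Real.log_le_log (by positivity) ?_
    gcongr
    linarith
  have hl3 : Real.log (2 * (m : ℝ) ^ 2 / δ) ≤ 3 * Real.log ((m : ℝ) / δ) := by
    have h1 : 3 * Real.log ((m : ℝ) / δ) = Real.log (((m : ℝ) / δ) ^ 3) := by
      rw [Real.log_pow]
      norm_num
    rw [h1]
    refine Real.log_le_log (by positivity) ?_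
    have h2 : 2 * (m : ℝ) ^ 2 / δ = 2 * m * (m / δ) := by ring
    rw [h2]
    calc 2 * m * (m / δ) ≤ (m / δ) * (m / δ) * (m / δ) := by
          refine mul_le_mul_of_nonneg_right ?_ (by linarith)
          nlinarith
      _ = _ := by ring
  have hsq : γ ^ 2 = k * Real.log ((m : ℝ) / δ) / m := by
    rw [hγeq, Real.sq_sqrt (by positivity)]
  have hε : Real.sqrt ((k * Real.log ((m : ℝ) / 2) + Real.log (4 / δ)) / m) ≤ 2 * γ := by
    rw [Real.sqrt_le_left (by linarith [hγ.1])]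
    have h1 : (2 * γ) ^ 2 = 4 * (k * Real.log ((m : ℝ) / δ)) / m := by
      rw [mul_pow, hsq]
      ring
    rw [h1]
    gcongr
    nlinarith
  have hlast : (1 / γ) * (44 * k * Real.log (2 * (m : ℝ) ^ 2 / δ)) / m ≤ 132 * γ := by
    have h1 : (1 / γ) * (44 * k * Real.log (2 * (m : ℝ) ^ 2 / δ)) / m
        ≤ (1 / γ) * (44 * k * (3 * Real.log ((m : ℝ) / δ))) / m := by
      have := hγ.1
      gcongr
    refine h1.trans (le_of_eq ?_)
    have h2 : (1 / γ) * (44 * k * (3 * Real.log ((m : ℝ) / δ))) / m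
        = 132 * (k * Real.log ((m : ℝ) / δ) / m) / γ := by ring
    rw [h2, ← hsq, div_eq_iff hγ.1.ne']
    ring
  have hγ0 := hγ.1
  have hγ2 := hγ.2
  -- In units of βγ the three errors are at most 2, 8 and 132, whence 142.
  have h1 : β * γ * r ≤ β * γ := mul_le_of_le_one_right (by positivity) hr.2
  have h2 : ((2 + 2 * γ) * β + 1) *
      Real.sqrt ((k * Real.log ((m : ℝ) / 2) + Real.log (4 / δ)) / m) ≤ (4 * β) * (2 * γ) :=
    mul_le_mul (by nlinarith) hε (Real.sqrt_nonneg _) (by positivity)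
  have h3 : 132 * γ ≤ 132 * (β * γ) := by nlinarith
  nlinarith

theorem measure_risk_Tout_gt_sqrt_le (hmeas : Measurable fun p : X × X => dist p.1 p.2)
    (hdiam : ∀ x y : X, dist x y ≤ 1) (P : Measure X) [IsProbabilityMeasure P] {k m : ℕ}
    (hm : 24 ≤ m) (hk : 1 ≤ k) (hkm : k ≤ m / 2) {δ : ℝ} (hδ : δ ∈ Set.Ioo (0 : ℝ) 1)
    {β : ℝ} (hβ : 1 ≤ β) (A : OfflineAlgorithm X k) (hA : A.IsApprox β) :
    Measure.pi (fun _ : Fin m => P)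
      {S | ¬ ((Tout hkm δ A S).Nonempty ∧
        risk P (Tout hkm δ A S) ≤ 2 * β * optRisk k P
          + 142 * β * Real.sqrt (k * Real.log ((m : ℝ) / δ) / m))}
      ≤ ENNReal.ofReal δ := by
  have hopt := optRisk_mem_Icc hmeas hdiam P hk
  have hm' : (24 : ℝ) ≤ m := by exact_mod_cast hm
  have hk' : (1 : ℝ) ≤ k := by exact_mod_cast hk
  have : Nonempty (Fin k) := ⟨⟨0, hk⟩⟩
  set w := Real.sqrt (k * Real.log ((m : ℝ) / δ) / m) with hw
  have hw0 : 0 < w := by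
    have hl : 0 < Real.log ((m : ℝ) / δ) := by
      refine Real.log_pos ?_
      rw [lt_div_iff₀ hδ.1]
      linarith [hδ.2]
    rw [hw]
    positivity
  by_cases hw2 : w < 1 / 2
  · refine (measure_mono fun S hS => ?_).trans
      (measure_risk_Tout_gt_le hmeas hdiam P hm hk hkm hδ hβ A hA ⟨hw0, hw2⟩)
    exact fun hgood => hS
      ⟨hgood.1, hgood.2.trans (two_mul_optRisk_bound hm hk hδ hβ hopt ⟨hw0, hw2⟩ hw)⟩
  -- For `w ≥ 1/2` this γ is inadmissible, but the error term already exceeds 1.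
  · refine (measure_mono fun S hS => ?_).trans ((measure_missesLargeBall_le hmeas P hm hδ).trans
      (ENNReal.ofReal_le_ofReal (by linarith [hδ.1])))
    by_contra hgood
    obtain ⟨f, -, hT⟩ := exists_Tout_eq_range hm hkm δ A hgood
    refine hS ⟨hT ▸ Set.range_nonempty _, ?_⟩
    rw [hT]
    refine (risk_mem_Icc hmeas hdiam P hk _).2.trans ?_
    have h1 : 0 ≤ 2 * β * optRisk k P := mul_nonneg (by linarith) hopt.1
    nlinarith

end Algorithm

end SKM

theorem theorem1 :
    ∃ C : ℝ, 0 < C ∧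
      ∀ (X : Type*) [MetricSpace X] [MeasurableSpace X]
        (_hmeas : Measurable fun p : X × X => dist p.1 p.2)
        (_hdiam : ∀ x y : X, dist x y ≤ 1)
        (k m : ℕ) (_hk : 1 ≤ k) (hm : max (2 * k) 24 ≤ m)
        (δ : ℝ) (_hδ : δ ∈ Set.Ioo (0 : ℝ) 1)
        (β : ℝ) (_hβ : 1 ≤ β)
        (A : SKM.OfflineAlgorithm X k) (_hA : A.IsApprox β)
        (P : MeasureTheory.Measure X) [MeasureTheory.IsProbabilityMeasure P],
        have hkm : k ≤ m / 2 := by omega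
        -- the (outer) probability that the bound fails is at most `δ`
        (∀ γ ∈ Set.Ioo (0 : ℝ) (1 / 2),
          MeasureTheory.Measure.pi (fun _ : Fin m => P)
            {S | ¬ ((SKM.Tout hkm δ A S).Nonempty ∧
              SKM.risk P (SKM.Tout hkm δ A S) ≤
                (2 + 2 * γ) * β * SKM.optRisk k P
                + ((2 + 2 * γ) * β + 1) *
                    Real.sqrt ((k * Real.log ((m : ℝ) / 2) + Real.log (4 / δ)) / m)
                + (1 / γ) * (44 * k * Real.log (2 * (m : ℝ) ^ 2 / δ)) / m)}
            ≤ ENNReal.ofReal δ) ∧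
        MeasureTheory.Measure.pi (fun _ : Fin m => P)
            {S | ¬ ((SKM.Tout hkm δ A S).Nonempty ∧
              SKM.risk P (SKM.Tout hkm δ A S) ≤
                2 * β * SKM.optRisk k P
                + C * β * Real.sqrt (k * Real.log ((m : ℝ) / δ) / m))}
            ≤ ENNReal.ofReal δ := by
  refine ⟨142, by norm_num, ?_⟩
  intro X _ _ hmeas hdiam k m hk hm δ hδ β hβ A hA P _ hkm
  have hm' : 24 ≤ m := (le_max_right _ _).trans hm
  exact ⟨fun γ hγ => SKM.measure_risk_Tout_gt_le hmeas hdiam P hm' hk hkm hδ hβ A hA hγ,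
    SKM.measure_risk_Tout_gt_sqrt_le hmeas hdiam P hm' hk hkm hδ hβ A hA⟩
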